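/- Let $n\ge 0$ and $r\ge 1$ be integers, let $|\cdot|$ be a norm on $\mathbb{R}^n$ and $\|\cdot\|$ the induced operator norm, and put $\mathbb{R}^+=[0,+\infty)$. Let $A\colon\mathbb{R}^+\to M_n(\mathbb{R})$ be continuous, let $f\colon \mathbb{R}^+\times\mathbb{R}^n\to\mathbb{R}^n$, and consider the systems $$\dot x=A(t)x \quad (1)\qquad\text{and}\qquad \dot y=A(t)y+f(t,y)\quad (2)\qquad (t\in\mathbb{R}^+).$$ Assume: (A1) $\sup_{t\ge 0}\|A(t)\|<+\infty$; (A2) there is $\mu>0$ with $|f(t,y)|\le\mu$ for all $(t,y)\in\mathbb{R}^+\times\mathbb{R}^n$; (A3) there is $\gamma>0$ with $|f(t,y)-f(t,y')|\le\gamma|y-y'|$ for all $t\ge 0$ and $y,y'\in\mathbb{R}^n$; (A4) system (1) has an exponential dichotomy on $\mathbb{R}^+$ with projection $P=I$, that is, there are $K,\alpha>0$ with $\|X(t,s)\|\le Ke^{-\alpha(t-s)}$ for all $t\ge s\ge 0$, where $X(t,s)=\Phi(t)\Phi(s)^{-1}$ is the transition matrix of (1) and $\Phi$ is any fundamental matrix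 of (1); (D4) for each $t\ge0$ the map $y\mapsto f(t,y)$ is of class $C^r$, and $f$ and its derivatives with respect to $y$ up to order $r$ are continuous functions of $(t,y)\in\mathbb{R}^+\times\mathbb{R}^n$. Then for all $\tau\ge 0$ and $\eta\in\mathbb{R}^n$ system (2) has a unique solution $t\mapsto y(t,\tau,\eta)$ on $\mathbb{R}^+$ with $y(\tau,\tau,\eta)=\eta$, and the systems (1) and (2) are $C^r$ continuously topologically equivalent on $\mathbb{R}^+$: there are maps $H,G\colon\mathbb{R}^+\times\mathbb{R}^n\to\mathbb{R}^n$ such that (i) for each $t\ge 0$ the maps $H(t,\cdot)$ and $G(t,\cdot)$ are homeomorphisms of $\mathbb{R}^n$ and inverse to each other; (ii) if $t\mapsto x(t)$ is a solution of (1) on $\mathbb{R}^+$, then $t\mapsto H(t,x(t))$ is a solution of (2), and if $t\mapsto y(t)$ is a solution of (2) on $\mathbb{R}^+$, then $t\mapsto G(t,y(t))$ is a solution of (1); (iii) $H(t,u)-u$ and $G(t,u)-u$ are bounded on $\mathbb{R}^+\times\mathbb{R}^n$; (iv) $H$ and $G$ are continuous on $\mathbb{R}^+\times\mathbb{R}^n$;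 (v) for each $t\ge 0$ the maps $H(t,\cdot)$ and $G(t,\cdot)$ are $C^r$ diffeomorphisms of $\mathbb{R}^n$, and the derivatives of $H$ and $G$ with respect to $u$ up to order $r$ are continuous functions of $(t,u)\in\mathbb{R}^+\times\mathbb{R}^n$. Moreover, for all $t\ge0$ and $\eta\in\mathbb{R}^n$ the map $y(0,t,\cdot)$ is differentiable at $\eta$ and $$\frac{\partial G}{\partial\eta}(t,\eta)=X(t,0)\,\frac{\partial y(0,t,\eta)}{\partial\eta}.$$ -/

import Mathlib

/-- `x` is a solution of `ẋ = F(t, x)` on the time set `J`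
(with the one-sided derivative at an endpoint of `J`). -/
def IsSolutionOn {E : Type*} [NormedAddCommGroup E] [NormedSpace ℝ E]
    (F : ℝ → E → E) (J : Set ℝ) (x : ℝ → E) : Prop :=
  ∀ t ∈ J, HasDerivWithinAt x (F t (x t)) J t

/-- `y t τ η` is, for `t, τ ∈ J`, the value at time `t` of the unique solution of
`ẏ = F(t, y)` on `J` passing through `η` at time `τ`. -/
structure IsGeneralSolutionOn {E : Type*} [NormedAddCommGroup E] [NormedSpace ℝ E]
    (F : ℝ → E → E) (J : Set ℝ) (y : ℝ → ℝ → E → E) : Prop where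
  isSolution : ∀ τ ∈ J, ∀ η : E, IsSolutionOn F J (fun t => y t τ η)
  initial : ∀ τ ∈ J, ∀ η : E, y τ τ η = η
  unique : ∀ x : ℝ → E, IsSolutionOn F J x → ∀ τ ∈ J, ∀ t ∈ J, x t = y t τ (x τ)

/-- The vector field of the linear system `ẋ = A(t) x`. -/
def linearField {E : Type*} [NormedAddCommGroup E] [NormedSpace ℝ E]
    (A : ℝ → E →L[ℝ] E) : ℝ → E → E :=
  fun t x => A t x

/-- The vector field of the quasilinear system `ẏ = A(t) y + f(t, y)`. -/
def quasilinearField {E : Type*} [NormedAddCommGroup E] [NormedSpace ℝ E]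
    (A : ℝ → E →L[ℝ] E) (f : ℝ → E → E) : ℝ → E → E :=
  fun t y => A t y + f t y

/-- `Φ` is a fundamental matrix of `ẋ = A(t) x` on `J`: an invertible matrix-valued function
with `Φ̇ = A Φ`. -/
def IsFundamentalMatrixOn {E : Type*} [NormedAddCommGroup E] [NormedSpace ℝ E]
    (A : ℝ → E →L[ℝ] E) (J : Set ℝ) (Φ : ℝ → E ≃L[ℝ] E) : Prop :=
  ∀ t ∈ J, HasDerivWithinAt (fun s => (Φ s : E →L[ℝ] E)) ((A t).comp (Φ t : E →L[ℝ] E)) J t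

/-- The transition matrix `X(t, s) = Φ(t) Φ(s)⁻¹`. -/
def transitionMatrix {E : Type*} [NormedAddCommGroup E] [NormedSpace ℝ E]
    (Φ : ℝ → E ≃L[ℝ] E) (t s : ℝ) : E →L[ℝ] E :=
  (Φ t : E →L[ℝ] E).comp ((Φ s).symm : E →L[ℝ] E)

/-- The system `ẋ = A(t) x` has an exponential dichotomy on `J` with projection `P`. -/
def HasExponentialDichotomyOn {E : Type*} [NormedAddCommGroup E] [NormedSpace ℝ E]
    (A : ℝ → E →L[ℝ] E) (J : Set ℝ) (P : E →L[ℝ] E) : Prop :=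
  P.comp P = P ∧
  ∃ Φ : ℝ → E ≃L[ℝ] E, IsFundamentalMatrixOn A J Φ ∧
    ∃ K α : ℝ, 0 < K ∧ 0 < α ∧
      (∀ t ∈ J, ∀ s ∈ J, s ≤ t →
        ‖(Φ t : E →L[ℝ] E).comp (P.comp ((Φ s).symm : E →L[ℝ] E))‖
          ≤ K * Real.exp (-α * (t - s))) ∧
      (∀ t ∈ J, ∀ s ∈ J, t ≤ s →
        ‖(Φ t : E →L[ℝ] E).comp
            ((ContinuousLinearMap.id ℝ E - P).comp ((Φ s).symm : E →L[ℝ] E))‖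
          ≤ K * Real.exp (-α * (s - t)))

/-- `h(t, ·)` is `C^r` for every `t ∈ J`, and the derivatives of `h` with respect to its second
variable of all orders `0, …, r` are continuous functions of `(t, u) ∈ J × E`. -/
def HasContinuousSpaceDerivsOn {E : Type*} [NormedAddCommGroup E] [NormedSpace ℝ E]
    (r : ℕ) (J : Set ℝ) (h : ℝ → E → E) : Prop :=
  (∀ t ∈ J, ContDiff ℝ r (h t)) ∧
  ∀ k : ℕ, k ≤ r →
    ContinuousOn (fun p : ℝ × E => iteratedFDeriv ℝ k (h p.1) p.2) (J ×ˢ Set.univ)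

/-- `H`, with inverse `G`, establishes a `J`-continuous topological equivalence between the systems
`ẋ = F₁(t, x)` and `ẏ = F₂(t, y)`. -/
structure IsContTopEquivOn {E : Type*} [NormedAddCommGroup E] [NormedSpace ℝ E]
    (F₁ F₂ : ℝ → E → E) (J : Set ℝ) (H G : ℝ → E → E) : Prop where
  /-- `G(t, ·)` is the inverse of `H(t, ·)`. -/
  leftInverse : ∀ t ∈ J, Function.LeftInverse (G t) (H t)
  rightInverse : ∀ t ∈ J, Function.RightInverse (G t) (H t)
  /-- `H` maps solutions of the first system into solutions of the second one. -/
  map_solution : ∀ x : ℝ → E, IsSolutionOn F₁ J x → IsSolutionOn F₂ J (fun t => H t (x t))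
  /-- `H(t, u) - u` is bounded on `J × E`. -/
  bounded : ∃ C : ℝ, ∀ t ∈ J, ∀ u : E, ‖H t u - u‖ ≤ C
  homeomorph : ∀ t ∈ J, IsHomeomorph (H t)
  continuousOn : ContinuousOn (fun p : ℝ × E => H p.1 p.2) (J ×ˢ Set.univ)
  /-- `G` maps solutions of the second system into solutions of the first one. -/
  inv_map_solution : ∀ y : ℝ → E, IsSolutionOn F₂ J y → IsSolutionOn F₁ J (fun t => G t (y t))
  /-- `G(t, u) - u` is bounded on `J × E`. -/
  inv_bounded : ∃ C : ℝ, ∀ t ∈ J, ∀ u : E, ‖G t u - u‖ ≤ C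
  inv_homeomorph : ∀ t ∈ J, IsHomeomorph (G t)
  inv_continuousOn : ContinuousOn (fun p : ℝ × E => G p.1 p.2) (J ×ˢ Set.univ)

/-- `H`, with inverse `G`, establishes a `C^r` continuous topological equivalence on `J`: it is a
`J`-continuous topological equivalence, the mutually inverse maps `H(t, ·)` and `G(t, ·)` are both
of class `C^r` (so that they are `C^r` diffeomorphisms), and their derivatives with respect to `u`
up to order `r` are continuous functions of `(t, u) ∈ J × E`. -/
structure IsCrContTopEquivOn {E : Type*} [NormedAddCommGroup E] [NormedSpace ℝ E]
    (r : ℕ) (F₁ F₂ : ℝ → E → E) (J : Set ℝ) (H G : ℝ → E → E) : Prop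
    extends IsContTopEquivOn F₁ F₂ J H G where
  contDerivs : HasContinuousSpaceDerivsOn r J H
  inv_contDerivs : HasContinuousSpaceDerivsOn r J G

/-! Solutions of the two systems are matched by their value at time 0: `H t u` follows the linear
flow from time `t` back to 0 and then the quasilinear flow forward to `t`, and `G t` does the
reverse. Uniqueness of solutions makes these maps mutually inverse and makes them carry solutions to
solutions. They stay near the identity by variation of constants: `x t - X(t,0) (x 0)` is the
integral of `X(t,s) f(s, x s)` over `[0, t]`, and exponential stability bounds it by `K * μ / α`
(`IsFundamentalMatrixOn.norm_sub_transitionMatrix_le`).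

The longest part is `C^r` dependence of the flow on the initial value, with derivatives continuous
in both times (`exists_flow_hasJointDerivs`). Rescaling the time interval to `[0, 1]` turns both
times into parameters. The induction on `r` in `hasJointDerivs_of_hasDerivWithinAt` adjoins the
variational equation to the system: the derivative of the flow is a component of a solution of a
system with one derivative less. Grönwall's inequality supplies continuity in the parameters and the
first derivative (`hasFDerivAt_of_variational_equation`). -/

open Set Filter Topology
open scoped NNReal

universe u v

/-! ### Calculus of parametrized `C^r` maps with jointly continuous derivatives. -/

/-- The maps `h θ` are of class `C^r`, and their derivatives up to order `r` depend continuously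
on the parameter and the point. -/
def HasJointDerivs {Θ : Type v} [TopologicalSpace Θ] {P : Type u} [NormedAddCommGroup P]
    [NormedSpace ℝ P] : ℕ → ∀ {F : Type u} [NormedAddCommGroup F] [NormedSpace ℝ F],
      (Θ → P → F) → Prop
  | 0, _, _, _, h => Continuous fun q : Θ × P => h q.1 q.2
  | r + 1, F, _, _, h => (Continuous fun q : Θ × P => h q.1 q.2) ∧
      ∃ h' : Θ → P → P →L[ℝ] F, (∀ θ p, HasFDerivAt (h θ) (h' θ p) p) ∧ HasJointDerivs r h'

namespace HasJointDerivs

variable {Θ Θ' : Type v} [TopologicalSpace Θ] [TopologicalSpace Θ']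
  {P Q F G X : Type u} [NormedAddCommGroup P] [NormedSpace ℝ P]
  [NormedAddCommGroup Q] [NormedSpace ℝ Q] [NormedAddCommGroup F] [NormedSpace ℝ F]
  [NormedAddCommGroup G] [NormedSpace ℝ G] [NormedAddCommGroup X] [NormedSpace ℝ X]

theorem continuous {r : ℕ} {h : Θ → P → F} (hh : HasJointDerivs r h) :
    Continuous fun q : Θ × P => h q.1 q.2 := by
  cases r with
  | zero => exact hh
  | succ r => exact hh.1

theorem of_succ {r : ℕ} {h : Θ → P → F} (hh : HasJointDerivs (r + 1) h) :
    HasJointDerivs r h := by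
  induction r generalizing F with
  | zero => exact hh.1
  | succ r ih =>
    obtain ⟨hc, h', hd, hh'⟩ := hh
    exact ⟨hc, h', hd, ih hh'⟩

theorem clm_comp {r : ℕ} {h : Θ → P → F} (hh : HasJointDerivs r h) (L : F →L[ℝ] G) :
    HasJointDerivs r fun θ p => L (h θ p) := by
  induction r generalizing F G with
  | zero => exact L.continuous.comp hh.continuous
  | succ r ih =>
    obtain ⟨hc, h', hd, hh'⟩ := hh
    exact ⟨L.continuous.comp hc, fun θ p => L.comp (h' θ p),
      fun θ p => L.hasFDerivAt.comp p (hd θ p), ih hh' (ContinuousLinearMap.compL ℝ P F G L)⟩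

theorem add {r : ℕ} {h k : Θ → P → F} (hh : HasJointDerivs r h) (hk : HasJointDerivs r k) :
    HasJointDerivs r fun θ p => h θ p + k θ p := by
  induction r generalizing F with
  | zero => exact hh.continuous.add hk.continuous
  | succ r ih =>
    obtain ⟨hc, h', hd, hh'⟩ := hh
    obtain ⟨kc, k', kd, hk'⟩ := hk
    exact ⟨hc.add kc, fun θ p => h' θ p + k' θ p, fun θ p => (hd θ p).add (kd θ p), ih hh' hk'⟩

theorem prodMk {r : ℕ} {h : Θ → P → F} {k : Θ → P → G} (hh : HasJointDerivs r h)
    (hk : HasJointDerivs r k) : HasJointDerivs r fun θ p => (h θ p, k θ p) := by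
  simpa using (hh.clm_comp (ContinuousLinearMap.inl ℝ F G)).add
    (hk.clm_comp (ContinuousLinearMap.inr ℝ F G))

/-- Both terms of the product rule are again bilinear in one factor and the derivative of the other,
so the induction closes once the spaces and the bilinear map vary. -/
theorem bilinear {r : ℕ} {h : Θ → P → F} {k : Θ → P → G} (hh : HasJointDerivs r h)
    (hk : HasJointDerivs r k) (B : F →L[ℝ] G →L[ℝ] X) :
    HasJointDerivs r fun θ p => B (h θ p) (k θ p) := by
  induction r generalizing F G X with
  | zero => exact (B.continuous.comp hh.continuous).clm_apply hk.continuous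
  | succ r ih =>
    have hh0 := hh.of_succ
    have hk0 := hk.of_succ
    obtain ⟨hc, h', hd, hh'⟩ := hh
    obtain ⟨kc, k', kd, hk'⟩ := hk
    exact ⟨(B.continuous.comp hc).clm_apply kc,
      fun θ p => B.precompR P (h θ p) (k' θ p) + B.precompL P (h' θ p) (k θ p),
      fun θ p => B.hasFDerivAt_of_bilinear (hd θ p) (kd θ p),
      (ih hh0 hk' (B.precompR P)).add (ih hh' hk0 (B.precompL P))⟩

theorem const {r : ℕ} {c : Θ → F} (hc : Continuous c) :
    HasJointDerivs r fun θ (_ : P) => c θ := by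
  induction r generalizing F with
  | zero => exact hc.comp continuous_fst
  | succ r ih =>
    exact ⟨hc.comp continuous_fst, fun _ _ => 0, fun θ p => hasFDerivAt_const (c θ) p,
      ih continuous_const⟩

theorem linear {r : ℕ} {L : Θ → P →L[ℝ] F} (hL : Continuous L) :
    HasJointDerivs r fun θ p => L θ p := by
  have hc : Continuous fun q : Θ × P => L q.1 q.2 :=
    (hL.comp continuous_fst).clm_apply continuous_snd
  cases r with
  | zero => exact hc
  | succ r => exact ⟨hc, fun θ _ => L θ, fun θ p => (L θ).hasFDerivAt, const hL⟩

theorem clm_apply {r : ℕ} {L : Θ → F →L[ℝ] G} {h : Θ → P → F} (hh : HasJointDerivs r h)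
    (hL : Continuous L) : HasJointDerivs r fun θ p => L θ (h θ p) :=
  (const hL).bilinear hh (ContinuousLinearMap.id ℝ (F →L[ℝ] G))

theorem smul {r : ℕ} {c : Θ → ℝ} {h : Θ → P → F} (hh : HasJointDerivs r h) (hc : Continuous c) :
    HasJointDerivs r fun θ p => c θ • h θ p :=
  hh.clm_apply (L := fun θ => c θ • ContinuousLinearMap.id ℝ F) (hc.smul continuous_const)

theorem reindex {r : ℕ} {h : Θ → P → F} (hh : HasJointDerivs r h) {φ : Θ' → Θ}
    (hφ : Continuous φ) : HasJointDerivs r fun θ p => h (φ θ) p := by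
  induction r generalizing F with
  | zero => exact hh.continuous.comp ((hφ.comp continuous_fst).prodMk continuous_snd)
  | succ r ih =>
    obtain ⟨hc, h', hd, hh'⟩ := hh
    exact ⟨hc.comp ((hφ.comp continuous_fst).prodMk continuous_snd), fun θ p => h' (φ θ) p,
      fun θ p => hd (φ θ) p, ih hh'⟩

/-- Inner maps here are only projections of the augmented system or transition matrices, so this
linear case replaces the general chain rule. -/
theorem comp_clm {r : ℕ} {h : Θ → P → F} (hh : HasJointDerivs r h) {L : Θ → Q →L[ℝ] P}
    (hL : Continuous L) : HasJointDerivs r fun θ q => h θ (L θ q) := by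
  have hg : Continuous fun q : Θ × Q => (q.1, L q.1 q.2) :=
    continuous_fst.prodMk ((hL.comp continuous_fst).clm_apply continuous_snd)
  induction r generalizing F with
  | zero => exact hh.continuous.comp hg
  | succ r ih =>
    obtain ⟨hc, h', hd, hh'⟩ := hh
    exact ⟨hc.comp hg, fun θ q => (h' θ (L θ q)).comp (L θ),
      fun θ q => (hd θ (L θ q)).comp q (L θ).hasFDerivAt,
      (ih hh').bilinear (const hL) (ContinuousLinearMap.compL ℝ Q P F)⟩

/-- Up to a currying isometry, the derivative of order `k + 1` is the `k`-th derivative of `fderiv`;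
hence the assumptions pass to `fderiv`. -/
theorem of_iteratedFDeriv {r : ℕ} {h : Θ → P → F} (h1 : ∀ θ, ContDiff ℝ r (h θ))
    (h2 : ∀ k ≤ r, Continuous fun q : Θ × P => iteratedFDeriv ℝ k (h q.1) q.2) :
    HasJointDerivs r h := by
  have hc : Continuous fun q : Θ × P => h q.1 q.2 := by
    have := (ContinuousMultilinearMap.apply ℝ (fun _ : Fin 0 => P) F 0).continuous.comp
      (h2 0 (Nat.zero_le _))
    simpa [Function.comp_def] using this
  induction r generalizing F with
  | zero => exact hc
  | succ r ih =>
    have h3 : ∀ θ, ContDiff ℝ ((r : ℕ) + 1) (h θ) := fun θ => by simpa using h1 θ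
    have h4 : ∀ k ≤ r, Continuous fun q : Θ × P => iteratedFDeriv ℝ k (fderiv ℝ (h q.1)) q.2 := by
      intro k hk
      have := (continuousMultilinearCurryRightEquiv' ℝ k P F).continuous.comp
        (h2 (k + 1) (by omega))
      simpa [Function.comp_def, iteratedFDeriv_succ_eq_comp_right] using this
    refine ⟨hc, fun θ => fderiv ℝ (h θ), fun θ p =>
      ((contDiff_succ_iff_fderiv.1 (h3 θ)).1 p).hasFDerivAt,
      ih (fun θ => (contDiff_succ_iff_fderiv.1 (h3 θ)).2.2) h4 ?_⟩
    have := (ContinuousMultilinearMap.apply ℝ (fun _ : Fin 0 => P) (P →L[ℝ] F) 0).continuous.comp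
      (h4 0 (Nat.zero_le _))
    simpa [Function.comp_def] using this

theorem contDiff {r : ℕ} {h : Θ → P → F} (hh : HasJointDerivs r h) (θ : Θ) :
    ContDiff ℝ r (h θ) := by
  induction r generalizing F with
  | zero =>
    exact contDiff_zero.2 (hh.continuous.comp (continuous_const.prodMk continuous_id))
  | succ r ih =>
    obtain ⟨hc, h', hd, hh'⟩ := hh
    have : ContDiff ℝ ((r : ℕ) + 1) (h θ) := by
      refine contDiff_succ_iff_fderiv.2 ⟨fun p => (hd θ p).differentiableAt, by simp, ?_⟩
      rw [show fderiv ℝ (h θ) = h' θ from funext fun p => (hd θ p).fderiv]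
      exact ih hh'
    simpa using this

theorem continuous_iteratedFDeriv {r : ℕ} {h : Θ → P → F} (hh : HasJointDerivs r h) {k : ℕ}
    (hk : k ≤ r) : Continuous fun q : Θ × P => iteratedFDeriv ℝ k (h q.1) q.2 := by
  induction k generalizing F r with
  | zero =>
    simp only [iteratedFDeriv_zero_eq_comp]
    exact (continuousMultilinearCurryFin0 ℝ P F).symm.continuous.comp hh.continuous
  | succ k ih =>
    obtain ⟨r, rfl⟩ : ∃ m, r = m + 1 := ⟨r - 1, by omega⟩
    obtain ⟨hc, h', hd, hh'⟩ := hh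
    have := (continuousMultilinearCurryRightEquiv' ℝ k P F).symm.continuous.comp
      (ih hh' (by omega))
    simp only [iteratedFDeriv_succ_eq_comp_right]
    have e : ∀ θ, fderiv ℝ (h θ) = h' θ := fun θ => funext fun p => (hd θ p).fderiv
    simpa [Function.comp_def, e] using this

theorem hasContinuousSpaceDerivsOn {r : ℕ} {J : Set ℝ} {h : ℝ → P → P} {k : ℝ → P → P}
    (hh : HasJointDerivs r h) (hk : ∀ t ∈ J, h t = k t) :
    HasContinuousSpaceDerivsOn r J k := by
  refine ⟨fun t ht => hk t ht ▸ hh.contDiff t, fun m hm => ?_⟩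
  refine (hh.continuous_iteratedFDeriv hm).continuousOn.congr fun q hq => ?_
  simp only [hk q.1 hq.1]

end HasJointDerivs

theorem HasContinuousSpaceDerivsOn.hasJointDerivs {r : ℕ} {J : Set ℝ} {P : Type u}
    [NormedAddCommGroup P] [NormedSpace ℝ P] {h : ℝ → P → P}
    (hh : HasContinuousSpaceDerivsOn r J h) {φ : ℝ → ℝ} (hφ : Continuous φ) (hJ : ∀ t, φ t ∈ J) :
    HasJointDerivs r fun t p => h (φ t) p :=
  HasJointDerivs.of_iteratedFDeriv (fun t => hh.1 _ (hJ t)) fun k hk =>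
    (hh.2 k hk).comp_continuous ((hφ.comp continuous_fst).prodMk continuous_snd)
      fun q => ⟨hJ q.1, mem_univ _⟩

/-! ### Global existence for globally Lipschitz equations. -/

section GlobalExistence

variable {E : Type*} [NormedAddCommGroup E] [NormedSpace ℝ E] {F : ℝ → E → E} {K : ℝ≥0}

/-- Two solutions that agree at a time `m` can be glued there. -/
theorem hasDerivAt_glue_of_eq {x z : ℝ → E} {a b c d m : ℝ}
    (hx : ∀ t ∈ Ioo a b, HasDerivAt x (F t (x t)) t)
    (hz : ∀ t ∈ Ioo c d, HasDerivAt z (F t (z t)) t)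
    (hab : m ∈ Ioo a b) (hcd : m ∈ Ioo c d) (hm : x m = z m) :
    ∃ w : ℝ → E, (∀ t ≤ m, w t = x t) ∧ (∀ t, m ≤ t → w t = z t) ∧
      ∀ t ∈ Ioo a d, HasDerivAt w (F t (w t)) t := by
  classical
  let w : ℝ → E := fun t => if t ≤ m then x t else z t
  have h1 : ∀ t ≤ m, w t = x t := fun t ht => if_pos ht
  have h2 : ∀ t, m ≤ t → w t = z t := by
    intro t ht
    rcases ht.eq_or_lt with rfl | ht
    · rw [h1 m le_rfl, hm]
    · exact if_neg (not_le.2 ht)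
  refine ⟨w, h1, h2, fun t ht => ?_⟩
  rcases lt_trichotomy t m with h | h | h
  · rw [h1 t h.le]
    exact (hx t ⟨ht.1, h.trans hab.2⟩).congr_of_eventuallyEq
      ((eventually_le_nhds h).mono h1)
  · subst h
    have hl : HasDerivWithinAt w (F t (w t)) (Iic t) t := by
      rw [h1 t le_rfl]
      exact (hx t hab).hasDerivWithinAt.congr (fun s hs => h1 s hs) (h1 t le_rfl)
    have hr : HasDerivWithinAt w (F t (w t)) (Ici t) t := by
      rw [h2 t le_rfl]
      exact (hz t hcd).hasDerivWithinAt.congr (fun s hs => h2 s hs) (h2 t le_rfl)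
    have := hl.union hr
    rwa [Iic_union_Ici, hasDerivWithinAt_univ] at this
  · rw [h2 t h.le]
    exact (hz t ⟨hcd.1.trans h, ht.2⟩).congr_of_eventuallyEq
      ((eventually_ge_nhds h).mono h2)

variable [CompleteSpace E]

/-- The time span of the local solutions of a globally Lipschitz equation does not depend on the
initial data. -/
theorem exists_hasDerivAt_Ioo_of_lipschitz (hK : ∀ t, LipschitzWith K (F t))
    (hc : ∀ y, Continuous fun t => F t y) (t₀ : ℝ) (x₀ : E) :
    ∃ x : ℝ → E, x t₀ = x₀ ∧
      ∀ t ∈ Ioo (t₀ - 1 / (2 * (K + 1))) (t₀ + 1 / (2 * (K + 1))),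
        HasDerivAt x (F t (x t)) t := by
  set δ : ℝ := 1 / (2 * (K + 1)) with hδ
  have hδ0 : 0 < δ := by positivity
  obtain ⟨B, hB⟩ := isCompact_Icc.exists_bound_of_continuousOn
    (s := Icc (t₀ - δ) (t₀ + δ)) (hc x₀).continuousOn
  have hB0 : 0 ≤ B := (norm_nonneg _).trans (hB t₀ ⟨by linarith, by linarith⟩)
  lift B to ℝ≥0 using hB0
  -- The radius `B` is the bound for the field at `x₀`, so the speed on the ball is at most `(K + 1)
  -- * B` and the displacement in time `δ` at most `B / 2`. Thus `B` depends on the initial data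
  -- while `δ` does not.
  have hP : IsPicardLindelof F (tmin := t₀ - δ) (tmax := t₀ + δ)
      ⟨t₀, by linarith, by linarith⟩ x₀ B 0 (B + K * B) K := by
    refine ⟨fun t _ => (hK t).lipschitzOnWith, fun y _ => (hc y).continuousOn,
      fun t ht y hy => ?_, ?_⟩
    · have h1 : ‖F t y - F t x₀‖ ≤ K * ‖y - x₀‖ := (hK t).norm_sub_le y x₀
      have h2 : ‖y - x₀‖ ≤ B := by simpa [dist_eq_norm] using hy
      have h3 : ‖F t y‖ ≤ ‖F t x₀‖ + ‖F t y - F t x₀‖ := by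
        simpa using norm_add_le (F t x₀) (F t y - F t x₀)
      have h4 : (K : ℝ) * ‖y - x₀‖ ≤ K * B := by gcongr
      have := hB t ht
      push_cast
      linarith
    · have : (K + 1 : ℝ) * δ = 1 / 2 := by rw [hδ]; field_simp
      have h0 : (0 : ℝ) ≤ B := B.2
      simp only [add_sub_cancel_left, sub_sub_cancel, max_self]
      push_cast
      nlinarith
  obtain ⟨x, hx0, hx⟩ := hP.exists_eq_forall_mem_Icc_hasDerivWithinAt₀
  exact ⟨x, hx0, fun t ht => (hx t (Ioo_subset_Icc_self ht)).hasDerivAt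
    (Icc_mem_nhds ht.1 ht.2)⟩

theorem exists_forall_hasDerivAt_of_lipschitz (hK : ∀ t, LipschitzWith K (F t))
    (hc : ∀ y, Continuous fun t => F t y) (t₀ : ℝ) (x₀ : E) :
    ∃ x : ℝ → E, x t₀ = x₀ ∧ ∀ t, HasDerivAt x (F t (x t)) t := by
  -- Half the local time span: each local solution extends the interval by `e` and leaves an overlap
  -- of width `e` around which to glue.
  set e : ℝ := 1 / (2 * (K + 1)) / 2 with he
  have he0 : 0 < e := by positivity
  have hloc : ∀ t₁ x₁, ∃ x : ℝ → E, x t₁ = x₁ ∧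
      ∀ t ∈ Ioo (t₁ - 2 * e) (t₁ + 2 * e), HasDerivAt x (F t (x t)) t := by
    intro t₁ x₁
    have h2 : 2 * e = 1 / (2 * (K + 1)) := by rw [he]; ring
    rw [h2]
    exact exists_hasDerivAt_Ioo_of_lipschitz hK hc t₁ x₁
  have hstep : ∀ n : ℕ, ∃ x : ℝ → E, x t₀ = x₀ ∧
      ∀ t ∈ Ioo (t₀ - (n + 2) * e) (t₀ + (n + 2) * e), HasDerivAt x (F t (x t)) t := by
    intro n
    induction n with
    | zero => simpa using hloc t₀ x₀
    | succ n ih =>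
      obtain ⟨x, hx0, hx⟩ := ih
      have hn : (0 : ℝ) ≤ n * e := by positivity
      obtain ⟨z, hz0, hz⟩ := hloc (t₀ + (n + 1) * e) (x (t₀ + (n + 1) * e))
      obtain ⟨w, hw1, -, hw⟩ := hasDerivAt_glue_of_eq hx hz
        (m := t₀ + (n + 1) * e) ⟨by linarith, by linarith⟩ ⟨by linarith, by linarith⟩ hz0.symm
      obtain ⟨z', hz0', hz'⟩ := hloc (t₀ - (n + 1) * e) (w (t₀ - (n + 1) * e))
      obtain ⟨w', -, hw2', hw'⟩ := hasDerivAt_glue_of_eq hz' hw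
        (m := t₀ - (n + 1) * e) ⟨by linarith, by linarith⟩ ⟨by linarith, by linarith⟩ hz0'
      refine ⟨w', ?_, fun t ht => hw' t ?_⟩
      · rw [hw2' t₀ (by linarith), hw1 t₀ (by linarith), hx0]
      · push_cast at ht
        exact ⟨by linarith [ht.1], by linarith [ht.2]⟩
  choose x hx0 hx using hstep
  have huniq : ∀ (m n : ℕ) (t : ℝ), t ∈ Ioo (t₀ - (m + 2) * e) (t₀ + (m + 2) * e) →
      t ∈ Ioo (t₀ - (n + 2) * e) (t₀ + (n + 2) * e) → x m t = x n t := by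
    have key : ∀ m n : ℕ, m ≤ n → ∀ t, t ∈ Ioo (t₀ - (m + 2) * e) (t₀ + (m + 2) * e) →
        x m t = x n t := by
      intro m n hmn t ht
      have hmn' : (m : ℝ) ≤ n := by exact_mod_cast hmn
      have h1 : (m : ℝ) * e ≤ n * e := by gcongr
      have h0 : (0 : ℝ) ≤ m * e := by positivity
      exact ODE_solution_unique_of_mem_Ioo (s := fun _ => univ) (t₀ := t₀)
        (fun s _ => (hK s).lipschitzOnWith) ⟨by linarith, by linarith⟩
        (fun s hs => ⟨hx m s hs, mem_univ _⟩)
        (fun s hs => ⟨hx n s ⟨by linarith [hs.1], by linarith [hs.2]⟩, mem_univ _⟩)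
        ((hx0 m).trans (hx0 n).symm) ht
    intro m n t hm hn
    rcases le_total m n with h | h
    · exact key m n h t hm
    · exact (key n m h t hn).symm
  have hN : ∀ t : ℝ, ∃ n : ℕ, t ∈ Ioo (t₀ - (n + 2) * e) (t₀ + (n + 2) * e) := by
    intro t
    obtain ⟨n, hn⟩ := exists_nat_gt (|t - t₀| / e)
    rw [div_lt_iff₀ he0, abs_lt] at hn
    exact ⟨n, by linarith [hn.1], by linarith [hn.2]⟩
  choose N hN using hN
  refine ⟨fun t => x (N t) t, hx0 _, fun t => ?_⟩
  refine (hx (N t) t (hN t)).congr_of_eventuallyEq ?_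
  filter_upwards [isOpen_Ioo.mem_nhds (hN t)] with s hs
  exact huniq _ _ s (hN s) hs

end GlobalExistence

/-! ### Grönwall estimates and continuous dependence on parameters. -/

/-- Homogeneity lets a small factor, such as `ε * ‖p - p₀‖`, be pulled out of the Grönwall bound. -/
theorem gronwallBound_mul (c a K b x : ℝ) :
    gronwallBound (c * a) K (c * b) x = c * gronwallBound a K b x := by
  unfold gronwallBound
  split_ifs <;> ring

/-- Grönwall's inequality on the unit interval. -/
theorem norm_le_mul_gronwallBound_of_unitInterval {E : Type*} [NormedAddCommGroup E]
    [NormedSpace ℝ E] {z z' : ℝ → E} {c a b K : ℝ} (hc : 0 ≤ c) (ha : 0 ≤ a) (hb : 0 ≤ b)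
    (hK : 0 ≤ K) (hz : ∀ s ∈ Icc (0 : ℝ) 1, HasDerivWithinAt z (z' s) (Icc 0 1) s)
    (h0 : ‖z 0‖ ≤ c * a) (hz' : ∀ s ∈ Icc (0 : ℝ) 1, ‖z' s‖ ≤ K * ‖z s‖ + c * b) :
    ∀ s ∈ Icc (0 : ℝ) 1, ‖z s‖ ≤ c * gronwallBound a K b 1 := by
  intro s hs
  rw [← gronwallBound_mul]
  refine (norm_le_gronwallBound_of_norm_deriv_right_le (f' := z') (a := 0) (b := 1)
    (fun t ht => (hz t ht).continuousWithinAt) (fun t ht => ?_) h0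
    (fun t ht => hz' t (Ico_subset_Icc_self ht)) s hs).trans ?_
  · exact (hz t (Ico_subset_Icc_self ht)).mono_of_mem_nhdsWithin
      (mem_of_superset (Icc_mem_nhdsGE ht.2) (Icc_subset_Icc_left ht.1))
  · exact gronwallBound_mono (mul_nonneg hc ha) (mul_nonneg hc hb) hK (by linarith [hs.2])

/-- `Y s` is continuous in its parameter, uniformly for `s` in the unit interval. -/
def ContinuousUniformlyInTime {Θ : Type*} [TopologicalSpace Θ] {E : Type*} [NormedAddCommGroup E]
    (Y : ℝ → Θ → E) : Prop :=
  ∀ θ₀, ∀ ε > 0, ∀ᶠ θ in 𝓝 θ₀, ∀ s ∈ Icc (0 : ℝ) 1, ‖Y s θ - Y s θ₀‖ ≤ ε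

section Parameters

variable {Θ : Type*} [TopologicalSpace Θ] {E : Type*} [NormedAddCommGroup E]

theorem ContinuousUniformlyInTime.continuous {Y : ℝ → Θ → E} (hY : ContinuousUniformlyInTime Y)
    {s : ℝ} (hs : s ∈ Icc (0 : ℝ) 1) : Continuous (Y s) := by
  refine continuous_iff_continuousAt.2 fun θ₀ => Metric.tendsto_nhds.2 fun ε hε => ?_
  filter_upwards [hY θ₀ (ε / 2) (by positivity)] with θ hθ
  rw [dist_eq_norm]
  linarith [hθ s hs]

theorem ContinuousUniformlyInTime.prodMk {G : Type*} [NormedAddCommGroup G] {Y : ℝ → Θ → E}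
    {Z : ℝ → Θ → G} (hY : ContinuousUniformlyInTime Y) (hZ : ContinuousUniformlyInTime Z) :
    ContinuousUniformlyInTime fun s θ => (Y s θ, Z s θ) := by
  intro θ₀ ε hε
  filter_upwards [hY θ₀ ε hε, hZ θ₀ ε hε] with θ h1 h2 s hs
  exact norm_prod_le_iff.2 ⟨h1 s hs, h2 s hs⟩

/-- Continuous dependence of solutions on a parameter of a Lipschitz equation. -/
theorem continuousUniformlyInTime_of_hasDerivWithinAt [NormedSpace ℝ E] {Y : ℝ → Θ → E}
    {F : ℝ → Θ → E → E}
    (hY : ∀ θ, ∀ s ∈ Icc (0 : ℝ) 1,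
      HasDerivWithinAt (fun s => Y s θ) (F s θ (Y s θ)) (Icc 0 1) s)
    (hK : ∀ θ₀, ∃ K : ℝ≥0, ∀ᶠ θ in 𝓝 θ₀, ∀ s ∈ Icc (0 : ℝ) 1, LipschitzWith K (F s θ))
    (hF : ∀ θ₀, ∀ ε > 0, ∀ᶠ θ in 𝓝 θ₀, ∀ s ∈ Icc (0 : ℝ) 1,
      ‖F s θ (Y s θ₀) - F s θ₀ (Y s θ₀)‖ ≤ ε)
    (h0 : Continuous (Y 0)) : ContinuousUniformlyInTime Y := by
  intro θ₀ ε hε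
  obtain ⟨K, hK⟩ := hK θ₀
  set B := gronwallBound 1 K 1 1
  have hη : 0 < ε / (|B| + 1) := by positivity
  have h0' := Metric.tendsto_nhds.1 (h0.tendsto θ₀) _ hη
  filter_upwards [hK, hF θ₀ _ hη, h0'] with θ hKθ hFθ h0θ s hs
  have := norm_le_mul_gronwallBound_of_unitInterval (z := fun s => Y s θ - Y s θ₀)
    (z' := fun s => F s θ (Y s θ) - F s θ₀ (Y s θ₀)) hη.le zero_le_one zero_le_one K.2
    (fun s hs => (hY θ s hs).sub (hY θ₀ s hs))
    (by rw [dist_eq_norm] at h0θ; simpa using h0θ.le) (fun s hs => ?_) s hs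
  · calc _ ≤ ε / (|B| + 1) * B := this
      _ ≤ ε / (|B| + 1) * (|B| + 1) := by
        gcongr
        linarith [le_abs_self B]
      _ = ε := by field_simp
  -- Change the state at fixed `θ` (Lipschitz), then the parameter along the fixed curve `Y s θ₀`.
  · have h1 := (hKθ s hs).norm_sub_le (Y s θ) (Y s θ₀)
    have h2 := hFθ s hs
    have h3 := norm_add_le (F s θ (Y s θ) - F s θ (Y s θ₀)) (F s θ (Y s θ₀) - F s θ₀ (Y s θ₀))
    rw [sub_add_sub_cancel] at h3
    rw [mul_one]
    exact h3.trans (add_le_add h1 h2)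

/-- A continuous function is close to its values along a compact curve, uniformly near the
curve. -/
theorem exists_forall_norm_sub_le_of_near_curve {X : Type*} [NormedAddCommGroup X]
    {g : ℝ × Θ → E → X} (hg : Continuous fun q : (ℝ × Θ) × E => g q.1 q.2) {y₀ : ℝ → E}
    (hy₀ : ContinuousOn y₀ (Icc 0 1)) (θ₀ : Θ) {ε : ℝ} (hε : 0 < ε) :
    ∃ δ > 0, ∀ᶠ θ in 𝓝 θ₀, ∀ s ∈ Icc (0 : ℝ) 1, ∀ y, ‖y - y₀ s‖ ≤ δ →
      ‖g (s, θ) y - g (s, θ₀) (y₀ s)‖ ≤ ε := by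
  set y₁ : ℝ → E := IccExtend (zero_le_one' ℝ) ((Icc (0 : ℝ) 1).domRestrict y₀)
  have hy₁ : Continuous y₁ := (continuousOn_iff_continuous_domRestrict.1 hy₀).Icc_extend'
  have hy : ∀ s ∈ Icc (0 : ℝ) 1, y₁ s = y₀ s := fun s hs => IccExtend_of_mem _ _ hs
  have hG : Continuous fun q : ℝ × (E × Θ) =>
      ‖g (q.1, q.2.2) (y₁ q.1 + q.2.1) - g (q.1, θ₀) (y₁ q.1)‖ := by
    have h1 : Continuous fun q : ℝ × (E × Θ) => g (q.1, q.2.2) (y₁ q.1 + q.2.1) :=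
      hg.comp (((continuous_fst.prodMk (continuous_snd.comp continuous_snd))).prodMk
        ((hy₁.comp continuous_fst).add (continuous_fst.comp continuous_snd)))
    have h2 : Continuous fun q : ℝ × (E × Θ) => g (q.1, θ₀) (y₁ q.1) :=
      hg.comp ((continuous_fst.prodMk continuous_const).prodMk (hy₁.comp continuous_fst))
    exact (h1.sub h2).norm
  -- Writing points as displacements from the curve makes the base point `(0, θ₀)` independent of
  -- `s`, so compactness of `[0, 1]` gives uniformity.
  have key : ∀ᶠ q : E × Θ in 𝓝 (0, θ₀), ∀ s ∈ Icc (0 : ℝ) 1,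
      ‖g (s, q.2) (y₁ s + q.1) - g (s, θ₀) (y₁ s)‖ ≤ ε := by
    refine isCompact_Icc.eventually_forall_of_forall_eventually fun s _ => ?_
    have h0 : ‖g (s, θ₀) (y₁ s + 0) - g (s, θ₀) (y₁ s)‖ < ε := by simpa using hε
    have hswap : Continuous fun q : (E × Θ) × ℝ =>
      ‖g (q.2, q.1.2) (y₁ q.2 + q.1.1) - g (q.2, θ₀) (y₁ q.2)‖ := hG.comp continuous_swap
    exact ((hswap.tendsto ((0, θ₀), s)).eventually_lt_const h0).mono fun q hq => hq.le
  rw [nhds_prod_eq, eventually_prod_iff] at key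
  obtain ⟨pa, hpa, pb, hpb, h⟩ := key
  obtain ⟨δ, hδ, hball⟩ := Metric.eventually_nhds_iff.1 hpa
  refine ⟨δ / 2, by positivity, hpb.mono fun θ hθ s hs y hys => ?_⟩
  have := h (x := y - y₀ s) (hball (by rw [dist_zero_right]; linarith)) hθ s hs
  simpa [hy s hs] using this

end Parameters

/-! ### Differentiability in the initial data and the smooth flow. -/

/-- Solutions of a continuously differentiable equation are differentiable with respect to their
initial data, and the derivative solves the variational equation. -/
theorem hasFDerivAt_of_variational_equation {E P : Type*} [NormedAddCommGroup E] [NormedSpace ℝ E]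
    [NormedAddCommGroup P] [NormedSpace ℝ P] {F : ℝ → E → E} {F' : ℝ → E → E →L[ℝ] E}
    {Y : ℝ → P → E} {W : ℝ → P →L[ℝ] E} {p₀ : P} {M : ℝ}
    (hF : ∀ s ∈ Icc (0 : ℝ) 1, ∀ y, HasFDerivAt (F s) (F' s y) y)
    (hF' : ∀ ε > 0, ∃ δ > 0, ∀ s ∈ Icc (0 : ℝ) 1, ∀ y, ‖y - Y s p₀‖ ≤ δ →
      ‖F' s y - F' s (Y s p₀)‖ ≤ ε)
    (hM : ∀ s ∈ Icc (0 : ℝ) 1, ‖F' s (Y s p₀)‖ ≤ M)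
    (hY : ∀ p, ∀ s ∈ Icc (0 : ℝ) 1, HasDerivWithinAt (fun s => Y s p) (F s (Y s p)) (Icc 0 1) s)
    (hYc : ContinuousUniformlyInTime Y)
    (hW : ∀ s ∈ Icc (0 : ℝ) 1, HasDerivWithinAt W ((F' s (Y s p₀)).comp (W s)) (Icc 0 1) s)
    (h0 : HasFDerivAt (Y 0) (W 0) p₀) :
    ∀ s ∈ Icc (0 : ℝ) 1, HasFDerivAt (Y s) (W s) p₀ := by
  intro s hs
  have hM0 : 0 ≤ M := (norm_nonneg _).trans (hM s hs)
  obtain ⟨C, hC⟩ := isCompact_Icc.exists_bound_of_continuousOn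
    (f := W) (s := Icc (0 : ℝ) 1) fun s hs => (hW s hs).continuousWithinAt
  have hC0 : 0 ≤ C := (norm_nonneg _).trans (hC s hs)
  rw [hasFDerivAt_iff_isLittleO, Asymptotics.isLittleO_iff]
  intro c hc
  set B := gronwallBound 1 (M + 1) C 1
  -- The condition `ε ≤ 1` keeps the Grönwall rate below `M + 1`, so that `B` can be fixed before
  -- `ε`.
  obtain ⟨ε, hε, hε1, hεB⟩ : ∃ ε > 0, ε ≤ 1 ∧ ε * B ≤ c := by
    refine ⟨min 1 (c / (|B| + 1)), by positivity, min_le_left _ _, ?_⟩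
    calc min 1 (c / (|B| + 1)) * B ≤ min 1 (c / (|B| + 1)) * (|B| + 1) := by
          gcongr
          linarith [le_abs_self B]
      _ ≤ c / (|B| + 1) * (|B| + 1) := by
          gcongr
          exact min_le_right _ _
      _ = c := by field_simp
  obtain ⟨δ, hδ, hF'⟩ := hF' ε hε
  rw [hasFDerivAt_iff_isLittleO, Asymptotics.isLittleO_iff] at h0
  filter_upwards [h0 hε, hYc p₀ δ hδ] with p h0p hYp
  have hd : ∀ t ∈ Icc (0 : ℝ) 1, HasDerivWithinAt (fun t => Y t p - Y t p₀ - W t (p - p₀))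
      (F t (Y t p) - F t (Y t p₀) - F' t (Y t p₀) (W t (p - p₀))) (Icc 0 1) t := fun t ht =>
    ((hY p t ht).sub (hY p₀ t ht)).sub
      ((ContinuousLinearMap.apply ℝ E (p - p₀)).hasFDerivAt.comp_hasDerivWithinAt t (hW t ht))
  have := norm_le_mul_gronwallBound_of_unitInterval (c := ε * ‖p - p₀‖) (a := 1) (b := C)
    (K := M + 1) (by positivity) zero_le_one hC0 (by positivity) hd
    (by simpa using h0p) (fun t ht => ?_) s hs
  · calc _ ≤ ε * ‖p - p₀‖ * B := this
      _ = ε * B * ‖p - p₀‖ := by ring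
      _ ≤ c * ‖p - p₀‖ := by gcongr
  -- The derivative of the remainder `z` is a first-order Taylor remainder of `F t`, small by the
  -- mean value inequality on a `δ`-ball, plus a linear term in `z`.
  · set z := Y t p - Y t p₀ - W t (p - p₀) with hz
    have e : F t (Y t p) - F t (Y t p₀) - F' t (Y t p₀) (W t (p - p₀)) =
        (F t (Y t p) - F t (Y t p₀) - F' t (Y t p₀) (Y t p - Y t p₀)) + F' t (Y t p₀) z := by
      simp only [hz, map_sub]; abel
    have h1 : ‖F t (Y t p) - F t (Y t p₀) - F' t (Y t p₀) (Y t p - Y t p₀)‖ ≤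
        ε * ‖Y t p - Y t p₀‖ :=
      (convex_closedBall (Y t p₀) δ).norm_image_sub_le_of_norm_hasFDerivWithin_le'
        (fun y _ => (hF t ht y).hasFDerivWithinAt)
        (fun y hy => hF' t ht y (by simpa [dist_eq_norm] using hy))
        (Metric.mem_closedBall_self hδ.le) (by simpa [dist_eq_norm] using hYp t ht)
    have h2 : ‖Y t p - Y t p₀‖ ≤ ‖z‖ + C * ‖p - p₀‖ := by
      have h3 : Y t p - Y t p₀ = z + W t (p - p₀) := by simp [hz]
      rw [h3]
      exact (norm_add_le _ _).trans (by gcongr; exact (W t).le_of_opNorm_le (hC t ht) _)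
    have h4 : ‖F' t (Y t p₀) z‖ ≤ M * ‖z‖ := (F' t (Y t p₀)).le_of_opNorm_le (hM t ht) _
    rw [e]
    calc _ ≤ ε * ‖Y t p - Y t p₀‖ + M * ‖z‖ := (norm_add_le _ _).trans (add_le_add h1 h4)
      _ ≤ ε * (‖z‖ + C * ‖p - p₀‖) + M * ‖z‖ := by gcongr
      _ = (M + ε) * ‖z‖ + ε * ‖p - p₀‖ * C := by ring
      _ ≤ (M + 1) * ‖z‖ + ε * ‖p - p₀‖ * C := by gcongr

/-- A linear equation with continuous coefficients is solvable on the unit interval. -/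
theorem exists_hasDerivWithinAt_clm_comp {E P : Type*} [NormedAddCommGroup E] [NormedSpace ℝ E]
    [CompleteSpace E] [NormedAddCommGroup P] [NormedSpace ℝ P] {a : ℝ → E →L[ℝ] E}
    (ha : ContinuousOn a (Icc 0 1)) (W₀ : P →L[ℝ] E) :
    ∃ W : ℝ → P →L[ℝ] E, W 0 = W₀ ∧
      ∀ s ∈ Icc (0 : ℝ) 1, HasDerivWithinAt W ((a s).comp (W s)) (Icc 0 1) s := by
  set b : ℝ → E →L[ℝ] E := IccExtend (zero_le_one' ℝ) ((Icc (0 : ℝ) 1).domRestrict a) with hb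
  have hbc : Continuous b := (continuousOn_iff_continuous_domRestrict.1 ha).Icc_extend'
  have hba : ∀ s ∈ Icc (0 : ℝ) 1, b s = a s := fun s hs => IccExtend_of_mem _ _ hs
  obtain ⟨M, hM⟩ := isCompact_Icc.exists_bound_of_continuousOn ha
  have hM0 : 0 ≤ M := (norm_nonneg _).trans (hM 0 (by simp))
  have hbM : ∀ s, ‖b s‖ ≤ M := fun s => hM _ (projIcc (0 : ℝ) 1 zero_le_one s).2
  lift M to ℝ≥0 using hM0
  obtain ⟨W, hW0, hW⟩ := exists_forall_hasDerivAt_of_lipschitz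
    (F := fun s (w : P →L[ℝ] E) => (b s).comp w) (K := M)
    (fun s => LipschitzWith.of_dist_le_mul fun w w' => by
      rw [dist_eq_norm, dist_eq_norm, ← ContinuousLinearMap.comp_sub]
      exact ((b s).opNorm_comp_le _).trans (by gcongr; exact hbM s))
    (fun w => hbc.clm_comp continuous_const) 0 W₀
  exact ⟨W, hW0, fun s hs => hba s hs ▸ (hW s).hasDerivWithinAt⟩

/-- Solutions of a `C^r` equation depend `C^r` on their initial data, and the derivatives depend
continuously on the parameters. -/
theorem hasJointDerivs_of_hasDerivWithinAt {Θ : Type v} [TopologicalSpace Θ] {P : Type u}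
    [NormedAddCommGroup P] [NormedSpace ℝ P] (r : ℕ) {E : Type u} [NormedAddCommGroup E]
    [NormedSpace ℝ E] [CompleteSpace E] {F : ℝ × Θ → E → E} (hF : HasJointDerivs r F)
    {Y : ℝ → Θ → P → E}
    (hY : ∀ θ p, ∀ s ∈ Icc (0 : ℝ) 1,
      HasDerivWithinAt (fun s => Y s θ p) (F (s, θ) (Y s θ p)) (Icc 0 1) s)
    (h0 : HasJointDerivs r (Y 0))
    (hYc : ContinuousUniformlyInTime fun s (q : Θ × P) => Y s q.1 q.2) :
    HasJointDerivs r (Y 1) := by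
  induction r generalizing E with
  | zero => exact hYc.continuous (by simp)
  | succ r ih =>
    have hF0 := hF.of_succ
    have h00 := h0.of_succ
    obtain ⟨-, F', hFd, hF'⟩ := hF
    obtain ⟨-, c', hc, hc'⟩ := h0
    have hYs : ∀ θ p, ContinuousOn (fun s => Y s θ p) (Icc 0 1) :=
      fun θ p s hs => (hY θ p s hs).continuousWithinAt
    have ha : ∀ θ p, ContinuousOn (fun s => F' (s, θ) (Y s θ p)) (Icc 0 1) := fun θ p =>
      hF'.continuous.comp_continuousOn
        ((Continuous.continuousOn (by fun_prop)).prodMk (hYs θ p))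
    have hac : ContinuousUniformlyInTime
        fun s (q : Θ × P) => F' (s, q.1) (Y s q.1 q.2) := by
      rintro ⟨θ₀, p₀⟩ ε hε
      obtain ⟨δ, hδ, h⟩ :=
        exists_forall_norm_sub_le_of_near_curve hF'.continuous (hYs θ₀ p₀) θ₀ hε
      have h' : ∀ᶠ q : Θ × P in 𝓝 (θ₀, p₀), ∀ s ∈ Icc (0 : ℝ) 1, ∀ y, ‖y - Y s θ₀ p₀‖ ≤ δ →
          ‖F' (s, q.1) y - F' (s, θ₀) (Y s θ₀ p₀)‖ ≤ ε :=
        (continuous_fst.tendsto (θ₀, p₀)).eventually h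
      filter_upwards [hYc (θ₀, p₀) δ hδ, h'] with q h1 h2 s hs
      exact h2 s hs _ (h1 s hs)
    choose W hW0 hW using fun θ p => exists_hasDerivWithinAt_clm_comp (ha θ p) (c' θ p)
    have hbound : ∀ θ p, ∃ M : ℝ≥0, ∀ s ∈ Icc (0 : ℝ) 1, ‖F' (s, θ) (Y s θ p)‖ ≤ M := by
      intro θ p
      obtain ⟨M, hM⟩ := isCompact_Icc.exists_bound_of_continuousOn (ha θ p)
      exact ⟨⟨M, (norm_nonneg _).trans (hM 0 (by simp))⟩, hM⟩
    have hWc : ContinuousUniformlyInTime fun s (q : Θ × P) => W q.1 q.2 s := by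
      refine continuousUniformlyInTime_of_hasDerivWithinAt
        (F := fun s q w => (F' (s, q.1) (Y s q.1 q.2)).comp w)
        (fun q s hs => hW q.1 q.2 s hs) (fun q₀ => ?_) (fun q₀ ε hε => ?_) ?_
      · obtain ⟨M, hM⟩ := hbound q₀.1 q₀.2
        -- Near `q₀` the coefficient of the variational equation differs by at most 1 from its value
        -- at `q₀`, which `M` bounds.
        refine ⟨M + 1, (hac q₀ 1 one_pos).mono fun q hq s hs =>
          LipschitzWith.of_dist_le_mul fun w w' => ?_⟩
        rw [dist_eq_norm, dist_eq_norm, ← ContinuousLinearMap.comp_sub]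
        refine (ContinuousLinearMap.opNorm_comp_le _ _).trans ?_
        gcongr
        have h1 := norm_le_norm_add_norm_sub' (F' (s, q.1) (Y s q.1 q.2))
          (F' (s, q₀.1) (Y s q₀.1 q₀.2))
        have h2 := hq s hs
        have h3 := hM s hs
        push_cast
        linarith
      · obtain ⟨C, hC⟩ := isCompact_Icc.exists_bound_of_continuousOn
          (f := W q₀.1 q₀.2) (s := Icc (0 : ℝ) 1)
          fun s hs => (hW q₀.1 q₀.2 s hs).continuousWithinAt
        have hC0 : 0 ≤ C := (norm_nonneg _).trans (hC 0 (by simp))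
        filter_upwards [hac q₀ (ε / (C + 1)) (by positivity)] with q hq s hs
        rw [← ContinuousLinearMap.sub_comp]
        calc _ ≤ ε / (C + 1) * C := (ContinuousLinearMap.opNorm_comp_le _ _).trans
              (mul_le_mul (hq s hs) (hC s hs) (norm_nonneg _) (by positivity))
          _ ≤ ε / (C + 1) * (C + 1) := by gcongr; linarith
          _ = ε := by field_simp
      · simpa only [hW0] using hc'.continuous
    have hWd : ∀ θ p, HasFDerivAt (Y 1 θ) (W θ p 1) p := by
      intro θ p
      obtain ⟨M, hM⟩ := hbound θ p
      refine hasFDerivAt_of_variational_equation (Y := fun s p => Y s θ p) (W := W θ p)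
        (F := fun s => F (s, θ)) (F' := fun s => F' (s, θ)) (fun s _ y => hFd (s, θ) y)
        (fun ε hε => ?_) hM (fun p => hY θ p) (fun p₀ ε hε => ?_) (hW θ p)
        (by simpa only [hW0] using hc θ p) 1 (by simp)
      · obtain ⟨δ, hδ, h⟩ :=
          exists_forall_norm_sub_le_of_near_curve hF'.continuous (hYs θ p) θ hε
        exact ⟨δ, hδ, h.self_of_nhds⟩
      · exact ((Continuous.prodMk_right θ).tendsto p₀).eventually (hYc (θ, p₀) ε hε)
    -- The equation together with its variational equation has a field with `r` derivatives. This
    -- field need not be globally Lipschitz, which is why solutions and their uniform continuity are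
    -- hypotheses of the induction.
    have hpair := ih (E := E × (P →L[ℝ] E))
      (F := fun q z => (F q z.1, (F' q z.1).comp z.2))
      (Y := fun s θ p => (Y s θ p, W θ p s))
      ((hF0.comp_clm (L := fun _ => ContinuousLinearMap.fst ℝ E (P →L[ℝ] E))
        continuous_const).prodMk
        ((hF'.comp_clm (L := fun _ => ContinuousLinearMap.fst ℝ E (P →L[ℝ] E))
          continuous_const).bilinear
          (HasJointDerivs.linear (L := fun _ => ContinuousLinearMap.snd ℝ E (P →L[ℝ] E))
            continuous_const) (ContinuousLinearMap.compL ℝ P E E)))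
      (fun θ p s hs => (hY θ p s hs).prodMk (hW θ p s hs))
      (by simpa only [hW0] using h00.prodMk hc') (hYc.prodMk hWc)
    exact ⟨hYc.continuous (by simp), fun θ p => W θ p 1, hWd,
      hpair.clm_comp (ContinuousLinearMap.snd ℝ E (P →L[ℝ] E))⟩

/-- A globally Lipschitz `C^r` equation has a flow that is `C^r` in the initial value, with
derivatives depending continuously on both times. -/
theorem exists_flow_hasJointDerivs {E : Type u} [NormedAddCommGroup E] [NormedSpace ℝ E]
    [CompleteSpace E] {r : ℕ} {F : ℝ → E → E} {K : ℝ≥0} (hK : ∀ t, LipschitzWith K (F t))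
    (hF : HasJointDerivs r F) :
    ∃ y : ℝ → ℝ → E → E, (∀ τ η, y τ τ η = η) ∧
      (∀ τ η t, HasDerivAt (fun t => y t τ η) (F t (y t τ η)) t) ∧
      (∀ s t τ η, y s t (y t τ η) = y s τ η) ∧
      HasJointDerivs r fun (θ : ℝ × ℝ) η => y θ.1 θ.2 η := by
  choose y hy0 hy using fun τ η => exists_forall_hasDerivAt_of_lipschitz hK
    (fun y => hF.continuous.comp (continuous_id.prodMk continuous_const)) τ η
  have huniq : ∀ s t τ η, y t (y τ η t) s = y τ η s := fun s t τ η =>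
    congrFun (ODE_solution_unique_univ (s := fun _ => univ) (t₀ := t)
      (fun s => (hK s).lipschitzOnWith) (fun s => ⟨hy _ _ s, mem_univ _⟩)
      (fun s => ⟨hy _ _ s, mem_univ _⟩) (hy0 _ _)) s
  refine ⟨fun t τ η => y τ η t, hy0, hy, huniq, ?_⟩
  -- Affine time change taking `[0, 1]` to the segment from `θ.2` to `θ.1`. The field acquires the
  -- factor `θ.1 - θ.2`, of any sign, so its Lipschitz constant is only locally uniform in `θ`.
  set φ : ℝ × (ℝ × ℝ) → ℝ := fun q => q.2.2 + q.1 * (q.2.1 - q.2.2) with hφ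
  have hφc : Continuous φ := by fun_prop
  have hfield : HasJointDerivs r
      fun (q : ℝ × (ℝ × ℝ)) (x : E) => (q.2.1 - q.2.2) • F (φ q) x :=
    (hF.reindex hφc).smul (by fun_prop)
  have hd : ∀ (θ : ℝ × ℝ) (p : E), ∀ s ∈ Icc (0 : ℝ) 1,
      HasDerivWithinAt (fun s => y θ.2 p (φ (s, θ)))
        ((θ.1 - θ.2) • F (φ (s, θ)) (y θ.2 p (φ (s, θ)))) (Icc 0 1) s := by
    intro θ p s _
    have h1 : HasDerivAt (fun s : ℝ => φ (s, θ)) (θ.1 - θ.2) s := by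
      simpa only [id_eq, one_mul] using ((hasDerivAt_id s).mul_const (θ.1 - θ.2)).const_add θ.2
    exact ((hy θ.2 p (φ (s, θ))).scomp s h1).hasDerivWithinAt
  have h := hasJointDerivs_of_hasDerivWithinAt r hfield
    (Y := fun s θ p => y θ.2 p (φ (s, θ))) hd ?_ ?_
  · simpa [hφ] using h
  · simpa [hφ, hy0] using
      HasJointDerivs.linear (Θ := ℝ × ℝ) (L := fun _ => ContinuousLinearMap.id ℝ E)
        continuous_const
  · refine continuousUniformlyInTime_of_hasDerivWithinAt
      (F := fun s (q : (ℝ × ℝ) × E) x => (q.1.1 - q.1.2) • F (φ (s, q.1)) x)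
      (fun q s hs => hd q.1 q.2 s hs) (fun q₀ => ?_) (fun q₀ ε hε => ?_) ?_
    · have hc : Continuous fun q : (ℝ × ℝ) × E => ‖q.1.1 - q.1.2‖₊ := by fun_prop
      refine ⟨(‖q₀.1.1 - q₀.1.2‖₊ + 1) * K, ?_⟩
      filter_upwards [(hc.tendsto q₀).eventually_lt_const (lt_add_one _)] with q hq s _
      refine ((lipschitzWith_smul (q.1.1 - q.1.2)).comp (hK _)).weaken ?_
      gcongr
    · obtain ⟨δ, hδ, h⟩ := exists_forall_norm_sub_le_of_near_curve
        (g := fun q x => (q.2.1 - q.2.2) • F (φ q) x) hfield.continuous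
        (fun s hs => (hd q₀.1 q₀.2 s hs).continuousWithinAt) q₀.1 hε
      filter_upwards [(continuous_fst.tendsto q₀).eventually h] with q hq s hs
      exact hq s hs _ (by simpa using hδ.le)
    · simpa [hφ, hy0] using continuous_snd

/-! ### Half-line solutions and variation of constants. -/

section Solutions

variable {E : Type*} [NormedAddCommGroup E] [NormedSpace ℝ E]

/-- Grönwall uniqueness is applied forward with right derivatives and backward with left ones; the
latter are needed only at positive times, so the endpoint 0 does no harm. -/
theorem IsSolutionOn.eq_of_lipschitz {F : ℝ → E → E} {K : ℝ≥0}
    (hK : ∀ t ∈ Ici (0 : ℝ), LipschitzWith K (F t)) {x z : ℝ → E}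
    (hx : IsSolutionOn F (Ici 0) x) (hz : IsSolutionOn F (Ici 0) z) {τ : ℝ} (hτ : τ ∈ Ici (0 : ℝ))
    (h : x τ = z τ) {t : ℝ} (ht : t ∈ Ici (0 : ℝ)) : x t = z t := by
  rw [mem_Ici] at hτ ht
  have hright : ∀ {w : ℝ → E}, IsSolutionOn F (Ici 0) w → ∀ s, 0 ≤ s →
      HasDerivWithinAt w (F s (w s)) (Ici s) s := fun hw s hs =>
    (hw s hs).mono (Ici_subset_Ici.2 hs)
  have hleft : ∀ {w : ℝ → E}, IsSolutionOn F (Ici 0) w → ∀ s, 0 < s →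
      HasDerivWithinAt w (F s (w s)) (Iic s) s := fun hw s hs =>
    ((hw s hs.le).hasDerivAt (Ici_mem_nhds hs)).hasDerivWithinAt
  have hcont : ∀ {w : ℝ → E}, IsSolutionOn F (Ici 0) w → ∀ {a b : ℝ}, 0 ≤ a →
      ContinuousOn w (Icc a b) := fun hw _ _ ha s hs =>
    (hw s (ha.trans hs.1)).continuousWithinAt.mono fun _ hu => ha.trans hu.1
  rcases le_total τ t with hle | hle
  · exact ODE_solution_unique_of_mem_Icc_right (s := fun _ => univ)
      (fun s hs => (hK s (hτ.trans hs.1)).lipschitzOnWith) (hcont hx hτ)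
      (fun s hs => hright hx s (hτ.trans hs.1)) (fun _ _ => mem_univ _) (hcont hz hτ)
      (fun s hs => hright hz s (hτ.trans hs.1)) (fun _ _ => mem_univ _) h ⟨hle, le_rfl⟩
  · exact ODE_solution_unique_of_mem_Icc_left (s := fun _ => univ)
      (fun s hs => (hK s (ht.trans hs.1.le)).lipschitzOnWith) (hcont hx ht)
      (fun s hs => hleft hx s (ht.trans_lt hs.1)) (fun _ _ => mem_univ _) (hcont hz ht)
      (fun s hs => hleft hz s (ht.trans_lt hs.1)) (fun _ _ => mem_univ _) h ⟨le_rfl, hle⟩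

variable {A : ℝ → E →L[ℝ] E} {Φ : ℝ → E ≃L[ℝ] E}

theorem IsFundamentalMatrixOn.isSolutionOn {J : Set ℝ} (hΦ : IsFundamentalMatrixOn A J Φ) (v : E) :
    IsSolutionOn (linearField A) J fun t => Φ t v := fun t ht =>
  (ContinuousLinearMap.apply ℝ E v).hasFDerivAt.comp_hasDerivWithinAt t (hΦ t ht)

/-- A solution of a linear system is determined by any fundamental matrix. -/
theorem IsFundamentalMatrixOn.eq_transitionMatrix {K : ℝ≥0}
    (hA : ∀ t ∈ Ici (0 : ℝ), ‖A t‖₊ ≤ K) (hΦ : IsFundamentalMatrixOn A (Ici 0) Φ) {x : ℝ → E}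
    (hx : IsSolutionOn (linearField A) (Ici 0) x) {t : ℝ} (ht : t ∈ Ici (0 : ℝ)) :
    x t = transitionMatrix Φ t 0 (x 0) :=
  IsSolutionOn.eq_of_lipschitz (F := linearField A)
    (fun s hs => (A s).lipschitz.weaken (hA s hs)) hx
    (hΦ.isSolutionOn ((Φ 0).symm (x 0))) self_mem_Ici (by simp) ht

/-- Operator inversion is smooth near an invertible operator. The value of the derivative can stay
unspecified. -/
theorem IsFundamentalMatrixOn.hasDerivWithinAt_symm [CompleteSpace E] {J : Set ℝ}
    (hΦ : IsFundamentalMatrixOn A J Φ) {t : ℝ} (ht : t ∈ J) :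
    ∃ Ψ : E →L[ℝ] E, HasDerivWithinAt (fun s => ((Φ s).symm : E →L[ℝ] E)) Ψ J t := by
  have h := ((contDiffAt_map_inverse (𝕜 := ℝ) (n := 1) (Φ t)).differentiableAt
    (by simp)).hasFDerivAt.comp_hasDerivWithinAt t (hΦ t ht)
  exact ⟨_, by simpa [Function.comp_def] using h⟩

/-- Variation of constants, in differential form. -/
theorem IsFundamentalMatrixOn.hasDerivWithinAt_symm_apply [CompleteSpace E]
    (hΦ : IsFundamentalMatrixOn A (Ici 0) Φ) {x : ℝ → E} {g : E} {t : ℝ} (ht : t ∈ Ici (0 : ℝ))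
    (hx : HasDerivWithinAt x (A t (x t) + g) (Ici 0) t) :
    HasDerivWithinAt (fun s => (Φ s).symm (x s)) ((Φ t).symm g) (Ici 0) t := by
  obtain ⟨Ψ, hΨ⟩ := hΦ.hasDerivWithinAt_symm ht
  have hw := hΨ.clm_apply hx
  -- Differentiating `Φ s ((Φ s).symm (x s)) = x s` and comparing with `hx` cancels `A t (x t)`,
  -- which determines the unknown derivative.
  have hx' := (hΦ t ht).clm_apply hw
  simp only [ContinuousLinearEquiv.coe_coe, ContinuousLinearEquiv.apply_symm_apply,
    ContinuousLinearMap.comp_apply] at hx'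
  have heq := (uniqueDiffOn_Ici (0 : ℝ) t ht).eq_deriv _ hx' hx
  rw [add_right_inj, ← ContinuousLinearEquiv.eq_symm_apply] at heq
  rw [← heq]
  exact hw

/-- Two solutions of a linear system and of a bounded perturbation of it that start at the same
point stay at a bounded distance if the linear system is exponentially stable. -/
theorem IsFundamentalMatrixOn.norm_sub_transitionMatrix_le [CompleteSpace E]
    (hΦ : IsFundamentalMatrixOn A (Ici 0) Φ) {K α μ : ℝ} (hα : 0 < α) (hK : 0 < K)
    (hdich : ∀ t ∈ Ici (0 : ℝ), ∀ s ∈ Ici (0 : ℝ), s ≤ t →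
      ‖transitionMatrix Φ t s‖ ≤ K * Real.exp (-α * (t - s)))
    {f : ℝ → E → E} (hμ : 0 < μ) (hf : ∀ t ∈ Ici (0 : ℝ), ∀ y, ‖f t y‖ ≤ μ) {x : ℝ → E}
    (hx : IsSolutionOn (quasilinearField A f) (Ici 0) x) {t : ℝ} (ht : t ∈ Ici (0 : ℝ)) :
    ‖x t - transitionMatrix Φ t 0 (x 0)‖ ≤ K * μ / α := by
  have hd : ∀ s ∈ Icc (0 : ℝ) t, HasDerivWithinAt
      (fun s => transitionMatrix Φ t s (x s) - transitionMatrix Φ t 0 (x 0))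
      (transitionMatrix Φ t s (f s (x s))) (Ici 0) s := fun s hs =>
    (((Φ t : E →L[ℝ] E).hasFDerivAt.comp_hasDerivWithinAt s
      (hΦ.hasDerivWithinAt_symm_apply hs.1 (hx s hs.1)))).sub_const _
  -- A majorant whose derivative is exactly the dichotomy bound on the speed; it is positive at `s =
  -- 0` and equals `K * μ / α` at `s = t`. This replaces the integral.
  have hB : ∀ s : ℝ, HasDerivAt (fun s => K * μ / α * Real.exp (-α * (t - s)))
      (K * Real.exp (-α * (t - s)) * μ) s := by
    intro s
    have h1 : HasDerivAt (fun s : ℝ => -α * (t - s)) (-α * -1) s :=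
      ((hasDerivAt_id s).const_sub t).const_mul (-α)
    refine (h1.exp.const_mul (K * μ / α)).congr_deriv ?_
    field_simp
  have := image_norm_le_of_norm_deriv_right_le_deriv_boundary (a := 0) (b := t)
    (fun s hs => (hd s hs).continuousWithinAt.mono fun _ hu => hu.1)
    (fun s hs => (hd s (Ico_subset_Icc_self hs)).mono (Ici_subset_Ici.2 hs.1))
    (by simpa using by positivity) hB
    (fun s hs => ((transitionMatrix Φ t s).le_of_opNorm_le_of_le
      (hdich t ht s hs.1 hs.2.le) (hf s hs.1 (x s)))) (right_mem_Icc.2 ht)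
  simpa [transitionMatrix] using this

end Solutions

/-! ### The topological equivalence. -/

theorem theorem7 {E : Type*} [NormedAddCommGroup E] [NormedSpace ℝ E] [FiniteDimensional ℝ E]
    (A : ℝ → E →L[ℝ] E) (f : ℝ → E → E) (r : ℕ) (hr : 1 ≤ r)
    (hA : ContinuousOn A (Set.Ici 0))
    (hA1 : ∃ M : ℝ, ∀ t ∈ Set.Ici (0 : ℝ), ‖A t‖ ≤ M)
    (hA2 : ∃ μ : ℝ, 0 < μ ∧ ∀ t ∈ Set.Ici (0 : ℝ), ∀ y : E, ‖f t y‖ ≤ μ)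
    (hA3 : ∃ γ : ℝ, 0 < γ ∧ ∀ t ∈ Set.Ici (0 : ℝ), ∀ y y' : E,
      ‖f t y - f t y'‖ ≤ γ * ‖y - y'‖)
    (hA4 : HasExponentialDichotomyOn A (Set.Ici 0) (ContinuousLinearMap.id ℝ E))
    (hD4 : HasContinuousSpaceDerivsOn r (Set.Ici 0) f) :
    ∃ y : ℝ → ℝ → E → E, IsGeneralSolutionOn (quasilinearField A f) (Set.Ici 0) y ∧
      ∃ H G : ℝ → E → E,
        IsCrContTopEquivOn r (linearField A) (quasilinearField A f) (Set.Ici 0) H G ∧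
        ∀ Φ : ℝ → E ≃L[ℝ] E, IsFundamentalMatrixOn A (Set.Ici 0) Φ →
          ∀ t ∈ Set.Ici (0 : ℝ), ∀ η : E,
            DifferentiableAt ℝ (fun u => y 0 t u) η ∧
            HasFDerivAt (G t)
              ((transitionMatrix Φ t 0).comp (fderiv ℝ (fun u => y 0 t u) η)) η := by
  have : CompleteSpace E := FiniteDimensional.complete ℝ E
  obtain ⟨M, hM⟩ := hA1
  obtain ⟨μ, hμ, hfμ⟩ := hA2
  obtain ⟨γ, hγ, hfγ⟩ := hA3
  obtain ⟨-, Φ, hΦ, K, α, hK, hα, hdich, -⟩ := hA4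
  replace hdich : ∀ t ∈ Ici (0 : ℝ), ∀ s ∈ Ici (0 : ℝ), s ≤ t →
      ‖transitionMatrix Φ t s‖ ≤ K * Real.exp (-α * (t - s)) := hdich
  lift M to ℝ≥0 using (norm_nonneg _).trans (hM 0 self_mem_Ici)
  lift γ to ℝ≥0 using hγ.le
  have hlip : ∀ t ∈ Ici (0 : ℝ), LipschitzWith (M + γ) (quasilinearField A f t) := fun t ht =>
    ((A t).lipschitz.weaken (hM t ht)).add
      (LipschitzWith.of_dist_le_mul fun y y' => by
        simpa only [dist_eq_norm] using hfγ t ht y y')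
  -- Freezing the system at time 0 for negative times makes it globally defined and Lipschitz
  -- without changing it on the half-line.
  have hmax : Continuous fun t : ℝ => max t 0 := by fun_prop
  have hmax0 : ∀ t : ℝ, max t 0 ∈ Ici (0 : ℝ) := fun t => le_max_right t 0
  have hmaxt : ∀ t ∈ Ici (0 : ℝ), max t 0 = t := fun t ht => max_eq_left ht
  obtain ⟨y, hy0, hy, hyy, hyr⟩ := exists_flow_hasJointDerivs (r := r)
    (F := fun t => quasilinearField A f (max t 0)) (fun t => hlip _ (hmax0 t))
    ((HasJointDerivs.linear (hA.comp_continuous hmax hmax0)).add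
      (hD4.hasJointDerivs hmax hmax0))
  have hysol : ∀ τ η, IsSolutionOn (quasilinearField A f) (Ici 0) fun t => y t τ η := by
    intro τ η t ht
    have := (hy τ η t).hasDerivWithinAt (s := Ici 0)
    rwa [hmaxt t ht] at this
  have hyuniq : ∀ x, IsSolutionOn (quasilinearField A f) (Ici 0) x →
      ∀ τ ∈ Ici (0 : ℝ), ∀ t ∈ Ici (0 : ℝ), x t = y t τ (x τ) := fun x hx τ hτ t ht =>
    hx.eq_of_lipschitz hlip (hysol τ (x τ)) hτ (hy0 _ _).symm ht
  have hlin : ∀ {Φ : ℝ → E ≃L[ℝ] E}, IsFundamentalMatrixOn A (Ici 0) Φ → ∀ {x},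
      IsSolutionOn (linearField A) (Ici 0) x → ∀ t ∈ Ici (0 : ℝ),
        x t = transitionMatrix Φ t 0 (x 0) :=
    fun hΦ _ hx _ ht => hΦ.eq_transitionMatrix hM hx ht
  set H : ℝ → E → E := fun t u => y t 0 (transitionMatrix Φ 0 t u) with hHdef
  set G : ℝ → E → E := fun t u => transitionMatrix Φ t 0 (y 0 t u) with hGdef
  have hX : ∀ t s u, transitionMatrix Φ t s (transitionMatrix Φ s t u) = u := by
    simp [transitionMatrix]
  have hΦc : Continuous fun t : ℝ => (Φ (max t 0) : E →L[ℝ] E) :=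
    ContinuousOn.comp_continuous (g := fun t => (Φ t : E →L[ℝ] E))
      (fun t ht => (hΦ t ht).continuousWithinAt) hmax hmax0
  have hΦsc : Continuous fun t : ℝ => ((Φ (max t 0)).symm : E →L[ℝ] E) :=
    ContinuousOn.comp_continuous (g := fun t => ((Φ t).symm : E →L[ℝ] E))
      (fun t ht => (hΦ.hasDerivWithinAt_symm ht).choose_spec.continuousWithinAt) hmax hmax0
  have hHr : HasJointDerivs r fun t u => y t 0 (transitionMatrix Φ 0 (max t 0) u) :=
    (hyr.reindex (Continuous.prodMk_left (0 : ℝ))).comp_clm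
      (continuous_const.clm_comp hΦsc)
  have hyr' : HasJointDerivs r fun t u => y 0 t u := hyr.reindex (Continuous.prodMk_right (0 : ℝ))
  have hGr : HasJointDerivs r fun t u => transitionMatrix Φ (max t 0) 0 (y 0 t u) :=
    hyr'.clm_apply (hΦc.clm_comp continuous_const)
  have hH : HasContinuousSpaceDerivsOn r (Ici 0) H :=
    hHr.hasContinuousSpaceDerivsOn fun t ht => by simp only [hmaxt t ht, hHdef]
  have hG : HasContinuousSpaceDerivsOn r (Ici 0) G :=
    hGr.hasContinuousSpaceDerivsOn fun t ht => by simp only [hmaxt t ht, hGdef]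
  have hGH : ∀ t, Function.LeftInverse (G t) (H t) := fun t u => by
    simp only [hHdef, hGdef, hyy, hy0, hX]
  have hHG : ∀ t, Function.RightInverse (G t) (H t) := fun t u => by
    simp only [hHdef, hGdef, hyy, hy0, hX]
  have hHb : ∀ t ∈ Ici (0 : ℝ), ∀ u, ‖H t u - u‖ ≤ K * μ / α := by
    intro t ht u
    simpa [hy0, hX] using hΦ.norm_sub_transitionMatrix_le hα hK hdich hμ hfμ
      (hysol 0 (transitionMatrix Φ 0 t u)) ht
  have hHcont : ∀ t ∈ Ici (0 : ℝ), Continuous (H t) := fun t ht => (hH.1 t ht).continuous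
  have hGcont : ∀ t ∈ Ici (0 : ℝ), Continuous (G t) := fun t ht => (hG.1 t ht).continuous
  refine ⟨y, ⟨fun τ _ η => hysol τ η, fun τ _ η => hy0 τ η, hyuniq⟩, H, G,
    { leftInverse := fun t _ => hGH t
      rightInverse := fun t _ => hHG t
      map_solution := fun x hx t ht => ?_
      bounded := ⟨_, hHb⟩
      homeomorph := fun t ht => (Homeomorph.mk ⟨H t, G t, hGH t, hHG t⟩ (hHcont t ht)
        (hGcont t ht)).isHomeomorph
      continuousOn := hHr.continuous.continuousOn.congr fun q hq => by
        simp only [hmaxt q.1 hq.1, hHdef]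
      inv_map_solution := fun x hx t ht => ?_
      inv_bounded := ⟨K * μ / α, fun t ht u => ?_⟩
      inv_homeomorph := fun t ht => (Homeomorph.mk ⟨G t, H t, hHG t, hGH t⟩ (hGcont t ht)
        (hHcont t ht)).isHomeomorph
      inv_continuousOn := hGr.continuous.continuousOn.congr fun q hq => by
        simp only [hmaxt q.1 hq.1, hGdef]
      contDerivs := hH
      inv_contDerivs := hG }, fun Φ' hΦ' t ht η => ?_⟩
  · have e : ∀ s ∈ Ici (0 : ℝ), H s (x s) = y s 0 (x 0) := fun s hs => by
      simp only [hHdef, hlin hΦ hx s hs, hX]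
    beta_reduce
    rw [e t ht]
    exact (hysol 0 (x 0) t ht).congr e (e t ht)
  · have e : ∀ s ∈ Ici (0 : ℝ), G s (x s) = Φ s ((Φ 0).symm (x 0)) := fun s hs => by
      simp only [hGdef, ← hyuniq x hx s hs 0 self_mem_Ici, transitionMatrix,
        ContinuousLinearMap.comp_apply, ContinuousLinearEquiv.coe_coe]
    beta_reduce
    rw [e t ht]
    exact (hΦ.isSolutionOn _ t ht).congr e (e t ht)
  -- `G t u - u` is the negative of the displacement of `H t` at `G t u`, so the same bound applies.
  · have := hHb t ht (G t u)
    rwa [hHG t u, norm_sub_rev] at this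
  · have hdiff : DifferentiableAt ℝ (fun u => y 0 t u) η :=
      (hyr'.contDiff t).differentiable (by exact_mod_cast (Nat.one_le_iff_ne_zero.1 hr)) η
    -- `G` was built from one fundamental matrix; uniqueness for the linear system shows that the
    -- transition matrix does not depend on that choice.
    have heq : transitionMatrix Φ' t 0 = transitionMatrix Φ t 0 := by
      ext v
      simpa [transitionMatrix] using hlin hΦ (hΦ'.isSolutionOn ((Φ' 0).symm v)) t ht
    rw [heq]
    exact ⟨hdiff, (transitionMatrix Φ t 0).hasFDerivAt.comp η hdiff.hasFDerivAt⟩
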